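/- Let $p$ be a prime and let $G$ be a finite non-cyclic group of order at most $p^p$ and of exponent $p$. Then every Sylow $p$-subgroup of $\operatorname{Aut}(G)$ has exponent exactly $p$. Moreover, Berkovich's Problem 1891 has a negative answer: there do not exist a prime $p$ and a group $G$ of order $p^p$ and exponent $p$ such that $p^2$ divides $\exp(\operatorname{Aut}(G))$. -/

import Mathlib

universe u

/-!
Let `A` be a finite `p`-group acting on `G`. In the `p`-group `G ⋊ A` the iterated commutators
`Gᵢ = [G, G ⋊ A, …, G ⋊ A]` decrease strictly until they vanish, so `|G| ≤ p ^ p` forces `Gₚ = 1`.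
Let `T` be the action of `a ∈ A` and fix `x ∈ G`. The `k`-th successive differences of the sequence
`n ↦ Tⁿ x` lie in `Gₖ`. By the theorem of Lazard and Leibman such polynomial sequences form a group,
so the sequence can be written as `∏ₖ cₖ ^ (n choose k)` with `cₖ ∈ Gₖ`. At `n = p` the factors
`0 < k < p` vanish because `p` divides both the binomial coefficient and the exponent of `G`, and
the factor `k = p` because `Gₚ = 1`; hence `Tᵖ x = x`.

Conversely, a `p`-group of order greater than `p` has an automorphism of order `p`, namely
`x ↦ x * φ x` for a nontrivial homomorphism `φ` onto a central subgroup of order `p` inside `ker φ`.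
-/

open scoped commutatorElement

/-- A decreasing sequence of subgroups with `⁅F i, F j⁆ ≤ F (i + j)`, also called an `N`-series.
Neither `F 0 = ⊤` nor `F 0 = F 1` is required. -/
structure CommutatorFiltration (G : Type*) [Group G] where
  toFun : ℕ → Subgroup G
  antitone : Antitone toFun
  commutator_le (i j : ℕ) : ⁅toFun i, toFun j⁆ ≤ toFun (i + j)

namespace CommutatorFiltration

variable {G : Type*} [Group G]

instance : CoeFun (CommutatorFiltration G) fun _ => ℕ → Subgroup G := ⟨toFun⟩

theorem mem_of_le (F : CommutatorFiltration G) {i j : ℕ} (hij : i ≤ j) {x : G} (hx : x ∈ F j) :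
    x ∈ F i :=
  F.antitone hij hx

theorem commutator_mem (F : CommutatorFiltration G) {i j : ℕ} {x y : G} (hx : x ∈ F i)
    (hy : y ∈ F j) : ⁅x, y⁆ ∈ F (i + j) :=
  F.commutator_le i j (Subgroup.commutator_mem_commutator hx hy)

theorem conj_mem (F : CommutatorFiltration G) {i j : ℕ} {g x : G} (hg : g ∈ F j) (hx : x ∈ F i) :
    g * x * g⁻¹ ∈ F i := by
  rw [← MulAut.conj_apply, conj_eq_commutatorElement_mul]
  exact mul_mem (F.mem_of_le (Nat.le_add_left i j) (F.commutator_mem hg hx)) hx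

/-- The elements `x` of each term `F i` with `x⁻¹ * T x` in `F (i + 1)`, for an endomorphism `T`.
That this is again a filtration is the inductive step of the Lazard–Leibman theorem. -/
def derived (F : CommutatorFiltration G) (T : G →* G) : CommutatorFiltration G where
  toFun i :=
    { carrier := {x | x ∈ F i ∧ x⁻¹ * T x ∈ F (i + 1)}
      one_mem' := ⟨one_mem _, by simp⟩
      mul_mem' := by
        rintro x y ⟨hx, hx'⟩ ⟨hy, hy'⟩
        have diff_mul : (x * y)⁻¹ * T (x * y) = y⁻¹ * (x⁻¹ * T x) * y⁻¹⁻¹ * (y⁻¹ * T y) := by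
          rw [map_mul]; group
        refine ⟨mul_mem hx hy, ?_⟩
        rw [diff_mul]
        exact mul_mem (F.conj_mem (inv_mem hy) hx') hy'
      inv_mem' := by
        rintro x ⟨hx, hx'⟩
        have diff_inv : x⁻¹⁻¹ * T x⁻¹ = x * (x⁻¹ * T x)⁻¹ * x⁻¹ := by
          rw [map_inv]; group
        refine ⟨inv_mem hx, ?_⟩
        rw [diff_inv]
        exact F.conj_mem hx (inv_mem hx') }
  antitone _ _ hij _ hx := ⟨F.mem_of_le hij hx.1, F.mem_of_le (Nat.succ_le_succ hij) hx.2⟩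
  commutator_le i j := by
    rw [Subgroup.commutator_le]
    rintro x ⟨hx, hx'⟩ y ⟨hy, hy'⟩
    have hTy : T y ∈ F j := by
      simpa using mul_mem hy (F.mem_of_le (Nat.le_succ j) hy')
    have diff_commutator : ⁅x, y⁆⁻¹ * T ⁅x, y⁆ =
        ⁅x, y⁆⁻¹ * (x * ⁅x⁻¹ * T x, T y⁆ * x⁻¹) * ⁅x, y⁆⁻¹⁻¹ * (y * ⁅x, y⁻¹ * T y⁆ * y⁻¹) := by
      rw [map_commutatorElement]; simp only [commutatorElement_def]; group
    have left_mem : ⁅x⁻¹ * T x, T y⁆ ∈ F (i + j + 1) :=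
      F.mem_of_le (by omega) (F.commutator_mem hx' hTy)
    have right_mem : ⁅x, y⁻¹ * T y⁆ ∈ F (i + j + 1) :=
      F.mem_of_le (by omega) (F.commutator_mem hx hy')
    refine ⟨F.commutator_mem hx hy, ?_⟩
    rw [diff_commutator]
    exact mul_mem (F.conj_mem (inv_mem (F.commutator_mem hx hy)) (F.conj_mem hx left_mem))
      (F.conj_mem hy right_mem)

/-- The termwise filtration on a power of a group. -/
def pi (F : CommutatorFiltration G) (ι : Type*) : CommutatorFiltration (ι → G) where
  toFun i := Subgroup.pi Set.univ fun _ => F i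
  antitone _ _ hij _ hf n hn := F.mem_of_le hij (hf n hn)
  commutator_le i j := by
    rw [Subgroup.commutator_le]
    exact fun f hf g hg n hn => F.commutator_mem (hf n hn) (hg n hn)

/-- The shift of sequences, as an endomorphism. -/
def shift (G : Type*) [Group G] : (ℕ → G) →* (ℕ → G) where
  toFun f n := f (n + 1)
  map_one' := rfl
  map_mul' _ _ := rfl

/-- The filtration of polynomial sequences, tested on `m` successive differences: `f` lies in
`F.polySeq m i` if for all `k ≤ m` the `k`-th differences of `f`, where the difference of `f` is
`n ↦ (f n)⁻¹ * f (n + 1)`, lie in `F (i + k)`. -/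
def polySeq (F : CommutatorFiltration G) : ℕ → CommutatorFiltration (ℕ → G)
  | 0 => F.pi ℕ
  | m + 1 => (F.polySeq m).derived (shift G)

variable {F : CommutatorFiltration G}

theorem mem_polySeq_zero {i : ℕ} {f : ℕ → G} : f ∈ F.polySeq 0 i ↔ ∀ n, f n ∈ F i := by
  simp [polySeq, pi, Subgroup.mem_pi]

theorem mem_polySeq_succ {m i : ℕ} {f : ℕ → G} :
    f ∈ F.polySeq (m + 1) i ↔
      f ∈ F.polySeq m i ∧ (fun n => (f n)⁻¹ * f (n + 1)) ∈ F.polySeq m (i + 1) :=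
  Iff.rfl

theorem apply_mem_of_mem_polySeq {m i : ℕ} {f : ℕ → G} (hf : f ∈ F.polySeq m i) (n : ℕ) :
    f n ∈ F i := by
  induction m with
  | zero => exact mem_polySeq_zero.1 hf n
  | succ m ih => exact ih (mem_polySeq_succ.1 hf).1

theorem pow_choose_mem_polySeq (m : ℕ) {i k : ℕ} {c : G} (hc : c ∈ F (i + k)) :
    (fun n => c ^ n.choose k) ∈ F.polySeq m i := by
  induction m generalizing i k with
  | zero => exact mem_polySeq_zero.2 fun _ => pow_mem (F.mem_of_le (Nat.le_add_right i k) hc) _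
  | succ m ih =>
    refine mem_polySeq_succ.2 ⟨ih hc, ?_⟩
    cases k with
    | zero =>
      simp only [Nat.choose_zero_right, pow_one, inv_mul_cancel]
      exact one_mem _
    | succ k =>
      have pascal : ∀ n : ℕ,
          (c ^ n.choose (k + 1))⁻¹ * c ^ (n + 1).choose (k + 1) = c ^ n.choose k := fun n => by
        rw [Nat.choose_succ_succ', Nat.add_comm (n.choose k), pow_add, inv_mul_cancel_left]
      simpa only [pascal] using ih (by rwa [add_right_comm])

theorem iterate_mem_polySeq {T : G →* G} (hT : ∀ i, ∀ x ∈ F i, x⁻¹ * T x ∈ F (i + 1)) (m : ℕ)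
    {i : ℕ} {x : G} (hx : x ∈ F i) : (fun n => T^[n] x) ∈ F.polySeq m i := by
  induction m generalizing i x with
  | zero =>
    have mapsTo : Set.MapsTo T (F i) (F i) := fun y hy => by
      simpa using mul_mem hy (F.mem_of_le (Nat.le_succ i) (hT i y hy))
    exact mem_polySeq_zero.2 fun n => mapsTo.iterate n hx
  | succ m ih =>
    refine mem_polySeq_succ.2 ⟨ih hx, ?_⟩
    simpa only [iterate_map_mul, iterate_map_inv, Function.iterate_succ_apply] using ih (hT i x hx)

theorem apply_mem_of_forall_lt_eq_one {m i k : ℕ} {f : ℕ → G} (hf : f ∈ F.polySeq m i)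
    (hk : k ≤ m) (hfk : ∀ n < k, f n = 1) : f k ∈ F (i + k) := by
  induction k generalizing m i f with
  | zero => exact apply_mem_of_mem_polySeq hf 0
  | succ k ih =>
    obtain ⟨m, rfl⟩ := Nat.exists_eq_add_of_le' hk
    have hdiff := ih (mem_polySeq_succ.1 hf).2 (Nat.le_add_left k m) fun n hn => by
      rw [hfk n (by omega), hfk (n + 1) (by omega), inv_one, one_mul]
    rwa [hfk k k.lt_succ_self, inv_one, one_mul, add_right_comm] at hdiff

variable {p : ℕ}

theorem apply_prime_eq_one_of_forall_lt_eq_one (hp : p.Prime) (hFp : F p = ⊥)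
    (hexp : ∀ x ∈ F 0, x ^ p = 1) {k : ℕ} (hk0 : 0 < k) (hkp : k ≤ p) {f : ℕ → G}
    (hf : f ∈ F.polySeq p 0) (hfk : ∀ n < k, f n = 1) : f p = 1 := by
  induction hkp using Nat.decreasingInduction generalizing f with
  | self => simpa [hFp] using apply_mem_of_forall_lt_eq_one hf le_rfl hfk
  | of_succ k hk ih =>
    have hc : (f k)⁻¹ ∈ F (0 + k) := inv_mem (apply_mem_of_forall_lt_eq_one hf hk.le hfk)
    have hpow : (f k)⁻¹ ^ p.choose k = 1 := by
      obtain ⟨d, hd⟩ := hp.dvd_choose_self hk0.ne' hk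
      rw [hd, pow_mul, hexp _ (F.mem_of_le (Nat.zero_le _) hc), one_pow]
    have hg : ∀ n < k + 1, f n * (f k)⁻¹ ^ n.choose k = 1 := fun n hn => by
      rcases Nat.lt_succ_iff_lt_or_eq.1 hn with hnk | rfl
      · rw [hfk n hnk, Nat.choose_eq_zero_of_lt hnk, pow_zero, one_mul]
      · rw [Nat.choose_self, pow_one, mul_inv_cancel]
    simpa only [Pi.mul_apply, hpow, mul_one] using
      ih k.succ_pos (mul_mem hf (pow_choose_mem_polySeq p hc)) hg

theorem apply_prime_eq_apply_zero (hp : p.Prime) (hFp : F p = ⊥) (hexp : ∀ x ∈ F 0, x ^ p = 1)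
    {f : ℕ → G} (hf : f ∈ F.polySeq p 0) : f p = f 0 := by
  have hconst : (fun _ => (f 0)⁻¹) ∈ F.polySeq p 0 := by
    simpa using pow_choose_mem_polySeq p (k := 0) (inv_mem (apply_mem_of_mem_polySeq hf 0))
  have := apply_prime_eq_one_of_forall_lt_eq_one hp hFp hexp one_pos hp.one_le
    (mul_mem hconst hf) fun n hn => by simp [Nat.lt_one_iff.1 hn]
  exact (inv_mul_eq_one.1 this).symm

theorem iterate_prime_apply_eq_self (hp : p.Prime) (hFp : F p = ⊥) (hexp : ∀ x ∈ F 0, x ^ p = 1)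
    {T : G →* G} (hT : ∀ i, ∀ x ∈ F i, x⁻¹ * T x ∈ F (i + 1)) {x : G} (hx : x ∈ F 0) :
    T^[p] x = x :=
  apply_prime_eq_apply_zero hp hFp hexp (iterate_mem_polySeq hT p hx)

end CommutatorFiltration

theorem commutator_commutator_le_of_rotate {G : Type*} [Group G] {A B C N : Subgroup G} [N.Normal]
    (h₁ : ⁅⁅B, C⁆, A⁆ ≤ N) (h₂ : ⁅⁅C, A⁆, B⁆ ≤ N) : ⁅⁅A, B⁆, C⁆ ≤ N := by
  have map_mk_eq_bot_iff (D : Subgroup G) : D.map (QuotientGroup.mk' N) = ⊥ ↔ D ≤ N := by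
    rw [Subgroup.map_eq_bot_iff, QuotientGroup.ker_mk']
  simp only [← map_mk_eq_bot_iff, Subgroup.map_commutator] at h₁ h₂ ⊢
  exact Subgroup.commutator_commutator_eq_bot_of_rotate h₁ h₂

/-- The iterated commutators `[N, H, …, H]`, the term of index `0` being `N`. For `N = ⊤` this is
the lower central series of `H`. -/
def relLowerCentralSeries {H : Type*} [Group H] (N : Subgroup H) : ℕ → Subgroup H
  | 0 => N
  | i + 1 => ⁅relLowerCentralSeries N i, ⊤⁆

section relLowerCentralSeries

variable {H : Type*} [Group H]

theorem relLowerCentralSeries_zero (N : Subgroup H) : relLowerCentralSeries N 0 = N := rfl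

theorem relLowerCentralSeries_succ (N : Subgroup H) (i : ℕ) :
    relLowerCentralSeries N (i + 1) = ⁅relLowerCentralSeries N i, ⊤⁆ := rfl

instance relLowerCentralSeries_normal (N : Subgroup H) [hN : N.Normal] (i : ℕ) :
    (relLowerCentralSeries N i).Normal := by
  induction i with
  | zero => exact hN
  | succ i ih => exact Subgroup.commutator_normal _ _

theorem relLowerCentralSeries_antitone (N : Subgroup H) [N.Normal] :
    Antitone (relLowerCentralSeries N) :=
  antitone_nat_of_succ_le fun _ => Subgroup.commutator_le_left _ _

theorem commutator_relLowerCentralSeries_le (N : Subgroup H) [N.Normal] (i j : ℕ) :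
    ⁅relLowerCentralSeries N i, relLowerCentralSeries N j⁆ ≤
      relLowerCentralSeries N (i + j + 1) := by
  induction j generalizing i with
  | zero => exact Subgroup.commutator_mono le_rfl le_top
  | succ j ih =>
    rw [Subgroup.commutator_comm, relLowerCentralSeries_succ N j]
    refine commutator_commutator_le_of_rotate ?_ (Subgroup.commutator_mono (ih i) le_top)
    rw [Subgroup.commutator_comm ⊤, ← relLowerCentralSeries_succ]
    exact (ih (i + 1)).trans_eq (by rw [add_right_comm i, add_assoc i])

/-- The filtration of `H` by the iterated commutators `[N, H, …, H]`. -/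
def relLowerCentralFiltration (N : Subgroup H) [N.Normal] : CommutatorFiltration H where
  toFun := relLowerCentralSeries N
  antitone := relLowerCentralSeries_antitone N
  commutator_le i j := (commutator_relLowerCentralSeries_le N i j).trans
    (relLowerCentralSeries_antitone N (Nat.le_succ _))

theorem commutator_top_lt_of_isNilpotent [Group.IsNilpotent H] {M : Subgroup H} [M.Normal]
    (hM : M ≠ ⊥) : ⁅M, (⊤ : Subgroup H)⁆ < M := by
  refine (Subgroup.commutator_le_left M ⊤).lt_of_ne fun h => hM ?_
  obtain ⟨n, hn⟩ := Subgroup.nilpotent_iff_lowerCentralSeries.1 ‹Group.IsNilpotent H›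
  have le_lowerCentralSeries (n : ℕ) : M ≤ (⊤ : Subgroup H).lowerCentralSeries n := by
    induction n with
    | zero => exact le_top
    | succ n ih => exact h.ge.trans (Subgroup.commutator_mono ih le_rfl)
  exact le_bot_iff.1 (hn ▸ le_lowerCentralSeries n)

variable [Finite H] {p : ℕ} [hp : Fact p.Prime]

theorem card_mul_prime_le_card_of_lt (hH : IsPGroup p H) {A B : Subgroup H} (hAB : A < B) :
    Nat.card A * p ≤ Nat.card B := by
  obtain ⟨a, ha⟩ := IsPGroup.iff_card.1 (hH.to_subgroup A)
  obtain ⟨b, hb⟩ := IsPGroup.iff_card.1 (hH.to_subgroup B)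
  have hcard : Nat.card A < Nat.card B :=
    lt_of_not_ge fun h => hAB.ne (Subgroup.eq_of_le_of_card_ge hAB.le h)
  rw [ha, hb] at hcard ⊢
  rw [← pow_succ]
  exact Nat.pow_le_pow_right hp.out.pos ((Nat.pow_lt_pow_iff_right hp.out.one_lt).1 hcard)

theorem relLowerCentralSeries_eq_bot_or_card_mul_pow_le (hH : IsPGroup p H) (N : Subgroup H)
    [N.Normal] (i : ℕ) : relLowerCentralSeries N i = ⊥ ∨
      Nat.card (relLowerCentralSeries N i) * p ^ i ≤ Nat.card N := by
  have := hH.isNilpotent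
  induction i with
  | zero => exact .inr (by rw [relLowerCentralSeries_zero, pow_zero, mul_one])
  | succ i ih =>
    rw [relLowerCentralSeries_succ]
    by_cases hbot : relLowerCentralSeries N i = ⊥
    · exact .inl (by rw [hbot, Subgroup.commutator_bot_left])
    · refine .inr (le_trans ?_ (ih.resolve_left hbot))
      rw [pow_succ', ← mul_assoc]
      exact Nat.mul_le_mul_right _
        (card_mul_prime_le_card_of_lt hH (commutator_top_lt_of_isNilpotent hbot))

theorem relLowerCentralSeries_eq_bot_of_card_le (hH : IsPGroup p H) {N : Subgroup H} [N.Normal]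
    {n : ℕ} (hN : Nat.card N ≤ p ^ n) : relLowerCentralSeries N n = ⊥ := by
  refine (relLowerCentralSeries_eq_bot_or_card_mul_pow_le hH N n).elim id fun h => ?_
  refine Subgroup.card_eq_one.1 (le_antisymm ?_ Nat.card_pos)
  exact Nat.le_of_mul_le_mul_right (by simpa using h.trans hN) (pow_pos hp.out.pos n)

theorem commute_pow_prime_of_card_le (hH : IsPGroup p H) {N : Subgroup H} [N.Normal]
    (hN : Nat.card N ≤ p ^ p) (hexp : ∀ x ∈ N, x ^ p = 1) (a : H) {x : H} (hx : x ∈ N) :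
    Commute (a ^ p) x := by
  have diff_mem : ∀ i, ∀ y ∈ relLowerCentralSeries N i,
      y⁻¹ * MulAut.conj a y ∈ relLowerCentralSeries N (i + 1) := fun i y hy => by
    rw [relLowerCentralSeries_succ, MulAut.conj_apply, ← mul_assoc, ← mul_assoc]
    simpa only [commutatorElement_def, inv_inv] using
      Subgroup.commutator_mem_commutator (inv_mem hy) (Subgroup.mem_top a)
  have hfix : (MulAut.conj a)^[p] x = x :=
    (relLowerCentralFiltration N).iterate_prime_apply_eq_self hp.out
      (relLowerCentralSeries_eq_bot_of_card_le hH hN) hexp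
      (T := (MulAut.conj a).toMonoidHom) diff_mem hx
  have iterate_conj : (MulAut.conj a)^[p] = MulAut.conj (a ^ p) := by
    rw [map_pow]
    exact (hom_coe_pow (fun α : MulAut H => ⇑α) rfl (fun _ _ => rfl) _ p).symm
  rwa [iterate_conj, MulAut.conj_apply, mul_inv_eq_iff_eq_mul] at hfix

end relLowerCentralSeries

section Automorphisms

variable {G : Type*} [Group G] {p : ℕ}

theorem isPGroup_semidirectProduct {A : Type*} [Group A] [Finite G] [Finite A] [Fact p.Prime]
    (φ : A →* MulAut G) (hG : IsPGroup p G) (hA : IsPGroup p A) : IsPGroup p (G ⋊[φ] A) := by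
  obtain ⟨m, hm⟩ := IsPGroup.iff_card.1 hG
  obtain ⟨n, hn⟩ := IsPGroup.iff_card.1 hA
  exact IsPGroup.of_card (n := m + n) (by rw [SemidirectProduct.card, hm, hn, pow_add])

theorem map_pow_prime_eq_one_of_card_le {A : Type*} [Group A] [Finite G] [Finite A]
    [hp : Fact p.Prime] (hcard : Nat.card G ≤ p ^ p) (hexp : ∀ x : G, x ^ p = 1)
    (hA : IsPGroup p A) (φ : A →* MulAut G) (a : A) : φ a ^ p = 1 := by
  have : Finite (G ⋊[φ] A) := .of_equiv _ SemidirectProduct.equivProd.symm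
  have hH : IsPGroup p (G ⋊[φ] A) :=
    isPGroup_semidirectProduct φ (fun x => ⟨1, by rw [pow_one, hexp]⟩) hA
  let N : Subgroup (G ⋊[φ] A) := SemidirectProduct.inl.range
  have : N.Normal := by
    rw [show N = _ from SemidirectProduct.range_inl_eq_ker_rightHom]
    infer_instance
  have hNcard : Nat.card N ≤ p ^ p := by
    rwa [← Nat.card_congr
      (MonoidHom.ofInjective (SemidirectProduct.inl_injective (φ := φ))).toEquiv]
  have hNexp : ∀ x ∈ N, x ^ p = 1 := by
    rintro _ ⟨x, rfl⟩
    rw [← map_pow, hexp, map_one]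
  ext x
  have hcomm : Commute (SemidirectProduct.inr a ^ p) (SemidirectProduct.inl x : G ⋊[φ] A) :=
    commute_pow_prime_of_card_le hH hNcard hNexp _ ⟨x, rfl⟩
  rw [MulAut.one_apply, ← map_pow, ← SemidirectProduct.inl_inj (φ := φ),
    SemidirectProduct.inl_aut, map_inv, map_pow, hcomm.eq, mul_inv_cancel_right]

/-- The automorphism `x ↦ x * φ x` attached to a homomorphism into the center that vanishes on its
own image. -/
def centralShear (φ : G →* Subgroup.center G) (hφ : ∀ x, φ (φ x) = 1) : MulAut G where
  toFun x := x * φ x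
  invFun x := x * (φ x)⁻¹
  left_inv x := by simp [hφ]
  right_inv x := by simp [hφ]
  map_mul' x y := by
    have hcomm : φ x * y = y * φ x := (Subgroup.mem_center_iff.1 (φ x).2 y).symm
    rw [map_mul, Subgroup.coe_mul, mul_assoc x, ← mul_assoc y, ← hcomm]
    simp only [mul_assoc]

theorem centralShear_pow_apply (φ : G →* Subgroup.center G) (hφ : ∀ x, φ (φ x) = 1) (n : ℕ)
    (x : G) : (centralShear φ hφ ^ n) x = x * (φ x : G) ^ n := by
  induction n with
  | zero => simp
  | succ n ih =>
    rw [pow_succ', MulAut.mul_apply, ih]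
    simp [centralShear, hφ, pow_succ, mul_assoc]

theorem orderOf_centralShear [hp : Fact p.Prime] {φ : G →* Subgroup.center G}
    (hφ : ∀ x, φ (φ x) = 1) (hφp : ∀ x, φ x ^ p = 1) (hφ1 : φ ≠ 1) :
    orderOf (centralShear φ hφ) = p := by
  refine orderOf_eq_prime ?_ fun h => hφ1 ?_
  · ext x
    rw [centralShear_pow_apply, ← Subgroup.coe_pow, hφp, Subgroup.coe_one, mul_one,
      MulAut.one_apply]
  · ext x
    simpa [h] using centralShear_pow_apply φ hφ 1 x

theorem exists_surjective_hom_of_card_eq_prime {C : Type*} [Group C] [Finite G] [Nontrivial G]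
    [hp : Fact p.Prime] (hG : IsPGroup p G) (hC : Nat.card C = p) :
    ∃ φ : G →* C, Function.Surjective φ := by
  obtain ⟨n, hn, hcard⟩ := hG.nontrivial_iff_card.1 ‹_›
  obtain ⟨M, hM⟩ := Sylow.exists_subgroup_card_pow_prime (G := G) p (n := n - 1)
    (hcard ▸ pow_dvd_pow p (Nat.sub_le n 1))
  have hindex : M.index = p := by
    refine Nat.eq_of_mul_eq_mul_left (pow_pos hp.out.pos (n - 1)) ?_
    rw [← hM, M.card_mul_index, hM, hcard, pow_sub_one_mul hn.ne']
  have : M.Normal := Subgroup.normal_of_index_eq_minFac_card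
    (by rw [hindex, hcard, hp.out.pow_minFac hn.ne'])
  let e : G ⧸ M ≃* C := mulEquivOfPrimeCardEq (p := p) hindex hC
  exact ⟨e.toMonoidHom.comp (QuotientGroup.mk' M),
    e.surjective.comp (QuotientGroup.mk'_surjective M)⟩

theorem exists_le_center_card_eq_prime [Finite G] [Nontrivial G] [hp : Fact p.Prime]
    (hG : IsPGroup p G) : ∃ Z ≤ Subgroup.center G, Nat.card Z = p := by
  have := hG.center_nontrivial
  have hcenter : p ∣ Nat.card (Subgroup.center G) :=
    (hG.to_subgroup _).card_eq_or_dvd.resolve_left Finite.one_lt_card.ne'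
  obtain ⟨z, hz⟩ := exists_prime_orderOf_dvd_card' p hcenter
  exact ⟨Subgroup.zpowers z, Subgroup.zpowers_le.2 z.2,
    by rw [Nat.card_zpowers, Subgroup.orderOf_coe, hz]⟩

theorem exists_hom_center_ne_one [Finite G] [hp : Fact p.Prime] (hG : IsPGroup p G)
    (hcard : p < Nat.card G) :
    ∃ φ : G →* Subgroup.center G, (∀ x, φ (φ x) = 1) ∧ (∀ x, φ x ^ p = 1) ∧ φ ≠ 1 := by
  have : Nontrivial G := Finite.one_lt_card_iff_nontrivial.1 (hp.out.one_lt.trans hcard)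
  obtain ⟨Z, hZ, hZcard⟩ := exists_le_center_card_eq_prime hG
  have : Z.Normal :=
    ⟨fun x hx g => by rwa [Subgroup.mem_center_iff.1 (hZ hx) g, mul_inv_cancel_right]⟩
  have : Nontrivial (G ⧸ Z) := QuotientGroup.nontrivial_iff.2 fun h =>
    hcard.ne (by rw [← hZcard, h, Subgroup.card_top])
  obtain ⟨ψ, hψ⟩ := exists_surjective_hom_of_card_eq_prime (hG.to_quotient Z) hZcard
  refine ⟨(Subgroup.inclusion hZ).comp (ψ.comp (QuotientGroup.mk' Z)), fun x => ?_,
    fun x => ?_, fun h => ?_⟩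
  · have hx : QuotientGroup.mk' Z (ψ (QuotientGroup.mk' Z x)) = 1 :=
      (QuotientGroup.eq_one_iff _).2 (ψ _).2
    simp only [MonoidHom.comp_apply, Subgroup.coe_inclusion, hx, map_one]
  · have hx : ψ (QuotientGroup.mk' Z x) ^ p = 1 := by rw [← hZcard, pow_card_eq_one']
    rw [MonoidHom.comp_apply, MonoidHom.comp_apply, ← map_pow, hx, map_one]
  · have hZ_eq_one (z : Z) : z = 1 := by
      obtain ⟨x, rfl⟩ := (hψ.comp (QuotientGroup.mk'_surjective Z)) z
      exact Subgroup.inclusion_injective hZ ((DFunLike.congr_fun h x).trans (map_one _).symm)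
    have : Subsingleton Z := ⟨fun y z => (hZ_eq_one y).trans (hZ_eq_one z).symm⟩
    exact hp.out.ne_one (hZcard.symm.trans (Nat.card_of_subsingleton 1))

theorem prime_dvd_card_mulAut [Finite G] [Fact p.Prime] (hG : IsPGroup p G)
    (hcard : p < Nat.card G) : p ∣ Nat.card (MulAut G) := by
  obtain ⟨φ, hφ, hφp, hφ1⟩ := exists_hom_center_ne_one hG hcard
  exact orderOf_centralShear hφ hφp hφ1 ▸ orderOf_dvd_natCard _

theorem prime_lt_card_of_not_isCyclic [Finite G] [hp : Fact p.Prime] (hG : IsPGroup p G)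
    (hcyc : ¬ IsCyclic G) : p < Nat.card G := by
  obtain ⟨n, hn⟩ := IsPGroup.iff_card.1 hG
  by_contra! hle
  have hn1 : n ≤ 1 := (Nat.pow_le_pow_iff_right hp.out.one_lt).1 (by rwa [pow_one, ← hn])
  exact hcyc (isCyclic_of_card_dvd_prime (p := p) (hn ▸ (pow_dvd_pow p hn1).trans (pow_one p).dvd))

theorem exponent_sylow_mulAut_eq_prime [Finite G] (hp : p.Prime)
    (hG : ¬ IsCyclic G) (hcard : Nat.card G ≤ p ^ p) (hexp : Monoid.exponent G = p)
    (P : Sylow p (MulAut G)) : Monoid.exponent P = p := by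
  have := Fact.mk hp
  have hpow : ∀ x : G, x ^ p = 1 := Monoid.exponent_dvd_iff_forall_pow_eq_one.1 hexp.dvd
  have hdvd : Monoid.exponent P ∣ p := Monoid.exponent_dvd_of_forall_pow_eq_one fun α =>
    Subtype.ext (map_pow_prime_eq_one_of_card_le hcard hpow P.isPGroup' P.toSubgroup.subtype α)
  have hGp : IsPGroup p G := fun x => ⟨1, by rw [pow_one, hpow]⟩
  have : Nontrivial P := (Subgroup.nontrivial_iff_ne_bot _).2 <| P.ne_bot_of_dvd_card <|
    prime_dvd_card_mulAut hGp (prime_lt_card_of_not_isCyclic hGp hG)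
  exact ((Nat.dvd_prime hp).1 hdvd).resolve_left fun h =>
    not_subsingleton P (Monoid.exp_eq_one_iff.1 h)

end Automorphisms

theorem exists_sylow_pow_dvd_exponent {A : Type*} [Group A] [Finite A] {p : ℕ} [hp : Fact p.Prime]
    {k : ℕ} (hk : p ^ k ∣ Monoid.exponent A) :
    ∃ P : Sylow p A, p ^ k ∣ Monoid.exponent P := by
  obtain ⟨a, ha⟩ := hp.out.exists_orderOf_eq_pow_factorization_exponent A
  have hk' : k ≤ (Monoid.exponent A).factorization p :=
    (hp.out.pow_dvd_iff_le_factorization Monoid.exponent_ne_zero_of_finite).1 hk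
  have hzpowers : IsPGroup p (Subgroup.zpowers a) :=
    IsPGroup.of_card (by rw [Nat.card_zpowers, ha])
  obtain ⟨P, hP⟩ := hzpowers.exists_le_sylow
  refine ⟨P, (pow_dvd_pow p hk').trans ?_⟩
  rw [← ha, ← Subgroup.orderOf_mk a (hP (Subgroup.mem_zpowers a))]
  exact Monoid.order_dvd_exponent _

theorem mainTheorem3 :
    (∀ (p : ℕ), p.Prime → ∀ (G : Type u) [Group G] [Finite G],
      ¬ IsCyclic G → Nat.card G ≤ p ^ p → Monoid.exponent G = p →
        ∀ P : Sylow p (MulAut G), Monoid.exponent P = p) ∧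
    ¬ ∃ (p : ℕ) (G : Type u) (_ : Group G),
      p.Prime ∧ Nat.card G = p ^ p ∧ Monoid.exponent G = p ∧
        p ^ 2 ∣ Monoid.exponent (MulAut G) := by
  refine ⟨fun p hp G _ _ => exponent_sylow_mulAut_eq_prime hp, ?_⟩
  rintro ⟨p, G, _, hp, hcard, hexp, hdvd⟩
  have := Fact.mk hp
  have : Finite G := Nat.finite_of_card_ne_zero (hcard ▸ (pow_pos hp.pos p).ne')
  have hcyc : ¬ IsCyclic G := fun _ =>
    (Nat.lt_pow_self hp.one_lt).ne (hexp.symm.trans (IsCyclic.exponent_eq_card.trans hcard))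
  obtain ⟨P, hP⟩ := exists_sylow_pow_dvd_exponent hdvd
  rw [exponent_sylow_mulAut_eq_prime hp hcyc hcard.le hexp] at hP
  exact (lt_self_pow₀ hp.one_lt one_lt_two).not_ge (Nat.le_of_dvd hp.pos hP)
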